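/- Let $N,n,m\in\mathbb N$, $\mathcal N=\{1,\dots,N\}$, and let $\|\cdot\|$ be the Euclidean norm. Each agent $i\in\mathcal N$ has a decision set $X_i\subseteq\mathbb R^n$, a function $f_i:\mathbb R^n\times\mathbb R^{n(N-1)}\to\mathbb R$ (for instance, but not necessarily, convex in $x_i$), and the function $$g_i(x_i,x_{-i},\xi)=\xi^\top Q_i\xi+P_i(x)^\top\xi,\qquad \xi\in\mathbb R^m,\qquad P_i(x)=A_ix+b_i,$$ where $x=(x_1,\dots,x_N)$ is the stacked decision vector, $A_i\in\mathbb R^{m\times nN}$, $b_i\in\mathbb R^m$, and $Q_i=L_i^\top D_iL_i$ with $L_i$ orthogonal and $D_i$ diagonal and positive semidefinite with sorted diagonal entries. Agent $i$ also has $K_i\ge 1$ samples $\xi_i^{(1)},\dots,\xi_i^{(K_i)}\in\mathbb R^m$, the empirical distribution $\hat{\mathbb P}_{K_i}=\frac1{K_i}\sum_{k=1}^{K_i}\delta_{\xi_i^{(k)}}$, and a radius $\varepsilon_i\ge 0$. Let $p\in\{1,2\}$, let $d_{W}(\mathbb Q_1,\mathbb Q_2)=\big(\inf_\Pi\int\|\xi_1-\xi_2\|^p\,\Pi(d\xi_1,d\xi_2)\big)^{1/p}\in[0,\infty]$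 be the Wasserstein distance of order $p$, where $\Pi$ ranges over the joint distributions with marginals $\mathbb Q_1,\mathbb Q_2$, and let $\mathcal P_i$ be the set of all probability measures $\mathbb Q$ on $\mathbb R^m$ with $d_W(\mathbb Q,\hat{\mathbb P}_{K_i})\le\varepsilon_i$. A vector $x^*\in\prod_i X_i$ is a distributionally robust Nash equilibrium of the game $G$ if for every $i\in\mathcal N$ $$x_i^*\in\operatorname*{arg\,min}_{x_i\in X_i}\ \sup_{\mathbb Q\in\mathcal P_i}\big\{f_i(x_i,x_{-i}^*)+\mathbb E_{\xi\sim\mathbb Q}[g_i(x_i,x_{-i}^*,\xi)]\big\}.$$ A pair $(x^*,\lambda^*)$ with $x^*\in\prod_iX_i$ and $\lambda^*\in[0,\infty)^N$ is a robust Nash equilibrium of the dual game $\bar G$ if for every $i\in\mathcal N$ $$(x_i^*,\lambda_i^*)\in\operatorname*{arg\,min}_{x_i\in X_i,\ \lambda_i\ge0}\ J_i(x_i,\lambda_i,x_{-i}^*),$$ $$J_i(x_i,\lambda_i,x_{-i})=f_i(x_i,x_{-i})+\lambda_i\varepsilon_i^2+\frac1{K_i}\sum_{k=1}^{K_i}\sup_{\xi\in\mathbb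 R^m}\big[\xi^\top Q_i\xi+P_i(x)^\top\xi-\lambda_i\|\xi-\xi_i^{(k)}\|^2\big].$$ All suprema, expectations and minimizations are taken in the extended reals. Then, for $p=2$ and also for $p=1$: if $(x^*,\lambda^*)$ is a robust Nash equilibrium of $\bar G$, then $x^*$ is a distributionally robust Nash equilibrium of $G$. -/

import Mathlib

open MeasureTheory
open scoped ENNReal Matrix

noncomputable section

namespace DRGame

/-- Joint distributions on `ℝᵐ × ℝᵐ` with marginals `μ` and `ν`. -/
def couplings {m : ℕ} (μ ν : Measure (EuclideanSpace ℝ (Fin m))) :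
    Set (Measure (EuclideanSpace ℝ (Fin m) × EuclideanSpace ℝ (Fin m))) :=
  {π | π.map Prod.fst = μ ∧ π.map Prod.snd = ν}

/-- The Wasserstein distance of order `p` for the Euclidean norm, with values in `[0, ∞]`:
`(inf_π ∫ ‖ξ₁ - ξ₂‖ ^ p dπ) ^ (1 / p)`. For `p = 1` this is `inf_π ∫ ‖ξ₁ - ξ₂‖ dπ`. -/
def wasserstein {m : ℕ} (p : ℕ) (μ ν : Measure (EuclideanSpace ℝ (Fin m))) : ℝ≥0∞ :=
  (⨅ π ∈ couplings μ ν, ∫⁻ z, ‖z.1 - z.2‖ₑ ^ p ∂π) ^ (1 / (p : ℝ))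

/-- The empirical distribution of `K` points. -/
def empirical {m K : ℕ} (s : Fin K → EuclideanSpace ℝ (Fin m)) :
    Measure (EuclideanSpace ℝ (Fin m)) :=
  (K : ℝ≥0∞)⁻¹ • ∑ k, Measure.dirac (s k)

/-- The extended-real expectation `E[h⁺] - E[h⁻]`. It is the usual one whenever `E[h⁻] < ∞`
or `E[h⁺] < ∞`, and equals the Bochner integral if `h` is integrable. -/
def expect {m : ℕ} (μ : Measure (EuclideanSpace ℝ (Fin m)))
    (h : EuclideanSpace ℝ (Fin m) → ℝ) : EReal :=
  ((∫⁻ ξ, ENNReal.ofReal (h ξ) ∂μ : ℝ≥0∞) : EReal)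
    - ((∫⁻ ξ, ENNReal.ofReal (-h ξ) ∂μ : ℝ≥0∞) : EReal)

end DRGame

/-- The data of a heterogeneous data-driven game with `N` agents, decisions in `ℝⁿ` and
uncertain parameters in `ℝᵐ`. A decision profile is a family `x : Fin N → ℝⁿ`. -/
structure DRGame (N n m : ℕ) where
  /-- the local decision sets -/
  X : Fin N → Set (EuclideanSpace ℝ (Fin n))
  /-- the deterministic costs, as functions of the whole profile `(x_i, x_{-i})` -/
  f : Fin N → (Fin N → EuclideanSpace ℝ (Fin n)) → ℝ
  /-- the matrices of the quadratic terms `ξᵀ Q_i ξ` -/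
  Q : Fin N → Matrix (Fin m) (Fin m) ℝ
  /-- the linear parts of the affine maps `P_i` -/
  A : Fin N → Matrix (Fin m) (Fin N × Fin n) ℝ
  /-- the constant parts of the affine maps `P_i` -/
  b : Fin N → Fin m → ℝ
  /-- the numbers of samples -/
  K : Fin N → ℕ
  K_pos : ∀ i, 0 < K i
  /-- the samples of each agent -/
  sample : (i : Fin N) → Fin (K i) → EuclideanSpace ℝ (Fin m)
  /-- the radii of the ambiguity sets -/
  ε : Fin N → ℝ
  ε_nonneg : ∀ i, 0 ≤ ε i

namespace DRGame

variable {N n m : ℕ}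

/-- `P_i(x) = A_i x + b_i`, where `x` is the stacked decision vector. -/
def P (G : DRGame N n m) (i : Fin N) (x : Fin N → EuclideanSpace ℝ (Fin n)) : Fin m → ℝ :=
  G.A i *ᵥ (fun j : Fin N × Fin n => x j.1 j.2) + G.b i

/-- `g_i(x_i, x_{-i}, ξ) = ξᵀ Q_i ξ + P_i(x)ᵀ ξ`. -/
def g (G : DRGame N n m) (i : Fin N) (x : Fin N → EuclideanSpace ℝ (Fin n))
    (ξ : EuclideanSpace ℝ (Fin m)) : ℝ :=
  (fun l => ξ l) ⬝ᵥ (G.Q i *ᵥ (fun l => ξ l)) + G.P i x ⬝ᵥ (fun l => ξ l)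

/-- Each `Q_i` equals `Lᵀ D L` with `L` orthogonal and `D` diagonal with nonnegative diagonal
entries, sorted in decreasing order. -/
def QuadraticForms (G : DRGame N n m) : Prop :=
  ∀ i, ∃ L ∈ Matrix.orthogonalGroup (Fin m) ℝ, ∃ d : Fin m → ℝ,
    Antitone d ∧ (∀ l, 0 ≤ d l) ∧ G.Q i = Lᵀ * Matrix.diagonal d * L

/-- The ambiguity set of agent `i`: the Wasserstein ball of order `p` and radius `ε_i` around
the empirical distribution of the agent's samples. -/
def ambiguitySet (G : DRGame N n m) (p : ℕ) (i : Fin N) :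
    Set (Measure (EuclideanSpace ℝ (Fin m))) :=
  {μ | IsProbabilityMeasure μ ∧
    wasserstein p μ (empirical (G.sample i)) ≤ ENNReal.ofReal (G.ε i)}

/-- The worst-case cost of agent `i` in the original game. -/
def worstCase (G : DRGame N n m) (p : ℕ) (i : Fin N)
    (x : Fin N → EuclideanSpace ℝ (Fin n)) : EReal :=
  ⨆ μ ∈ G.ambiguitySet p i, ((G.f i x : EReal) + expect μ (G.g i x))

/-- Distributionally robust Nash equilibria of the original game. -/
def IsDRNE (G : DRGame N n m) (p : ℕ) (x : Fin N → EuclideanSpace ℝ (Fin n)) : Prop :=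
  (∀ i, x i ∈ G.X i) ∧
    ∀ i, ∀ y ∈ G.X i, G.worstCase p i x ≤ G.worstCase p i (Function.update x i y)

/-- The cost `J_i(x_i, l, x_{-i})` of agent `i` in the dual game, with values in `(-∞, ∞]`. -/
def J (G : DRGame N n m) (i : Fin N) (x : Fin N → EuclideanSpace ℝ (Fin n)) (l : ℝ) : EReal :=
  ((G.f i x + l * G.ε i ^ 2 : ℝ) : EReal)
    + (((G.K i : ℝ)⁻¹ : ℝ) : EReal) *
      ∑ k, ⨆ ξ : EuclideanSpace ℝ (Fin m),
        ((G.g i x ξ - l * ‖ξ - G.sample i k‖ ^ 2 : ℝ) : EReal)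

/-- Robust Nash equilibria of the dual game. -/
def IsRNE (G : DRGame N n m) (x : Fin N → EuclideanSpace ℝ (Fin n)) (lam : Fin N → ℝ) : Prop :=
  (∀ i, x i ∈ G.X i ∧ 0 ≤ lam i) ∧
    ∀ i, ∀ y ∈ G.X i, ∀ l : ℝ, 0 ≤ l →
      G.J i x (lam i) ≤ G.J i (Function.update x i y) l

end DRGame

end

open Filter Topology

/-! Fix an agent and the others' decisions. If the worst case never exceeds `J`, then worst case at
`x*` ≤ `J` at `(x*, λ*)` ≤ `J` at `(y, l)` for all `l ≥ 0`. It then suffices that the infimum of the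
last term over `l` is at most the worst case at `y`.

That lower bound (`le_worstCase_of_forall_le_J`) holds for both orders. Up to any `δ`, the dual
value is reached by moving each sample once with mean squared displacement at most `ε²`, and by
Cauchy-Schwarz such a measure lies in the first order ball too.

The upper bound is weak duality for `p = 2`. For `p = 1` it holds when `Q = 0` (explicit linear
worst case) or `ε = 0` (the balls of both orders consist of measures at distance zero). In the
remaining case a first order ball permits small masses to travel far, so every decision has worst
case `⊤` and is optimal. -/

/-! ### Duality for separable quadratics -/

/-- Near-strong duality for the trust-region problem with averaged budget, in diagonal
coordinates. -/
theorem exists_dual_gap_le {κ ι : Type*} [Fintype κ] [Nonempty κ] [Fintype ι] [DecidableEq ι]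
    (c : κ → ι → ℝ) (d : ι → ℝ) (j₀ : ι) (hd : ∀ j, d j ≤ d j₀) (hd₀ : 0 ≤ d j₀)
    {ε δ : ℝ} (hε : 0 ≤ ε) (hδ : 0 < δ) :
    ∃ (l : ℝ) (B : κ → ℝ) (w : κ → ι → ℝ), 0 ≤ l ∧
      (∀ k (u : ι → ℝ), ∑ j, (c k j * u j + d j * u j ^ 2 - l * u j ^ 2) ≤ B k) ∧
      (Fintype.card κ : ℝ)⁻¹ * ∑ k, ∑ j, w k j ^ 2 ≤ ε ^ 2 ∧
      l * ε ^ 2 + (Fintype.card κ : ℝ)⁻¹ * ∑ k, B k ≤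
        (Fintype.card κ : ℝ)⁻¹ * ∑ k, ∑ j, (c k j * w k j + d j * w k j ^ 2) + δ := by
  set M : ℝ := (Fintype.card κ : ℝ)⁻¹ with hM
  have hM1 : M * Fintype.card κ = 1 := inv_mul_cancel₀ (by simp)
  -- For `l > d j₀` the penalized problem is strictly concave: `b` is its maximum, `v` its
  -- maximizer, and `r` the budget that the maximizers use.
  let b : ℝ → κ → ℝ := fun l k => ∑ j, c k j ^ 2 / (4 * (l - d j))
  let v : ℝ → κ → ι → ℝ := fun l k j => c k j / (2 * (l - d j))
  let r : ℝ → ℝ := fun l => M * ∑ k, ∑ j, v l k j ^ 2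
  have hpos : ∀ l, d j₀ < l → ∀ j, 0 < l - d j := fun l hl j => by linarith [hd j]
  have hB : ∀ l, d j₀ < l → ∀ k (u : ι → ℝ),
      ∑ j, (c k j * u j + d j * u j ^ 2 - l * u j ^ 2) ≤ b l k := by
    intro l hl k u
    refine Finset.sum_le_sum fun j _ => ?_
    have h := hpos l hl j
    rw [le_div_iff₀ (by linarith)]
    nlinarith [sq_nonneg (c k j - 2 * (l - d j) * u j)]
  have hval : ∀ l, d j₀ < l → ∀ k j,
      c k j * v l k j + d j * v l k j ^ 2 = c k j ^ 2 / (4 * (l - d j)) + l * v l k j ^ 2 := by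
    intro l hl k j
    have h := (hpos l hl j).ne'
    simp only [v]
    field_simp
    ring
  have hvc : ∀ l, d j₀ < l → ∀ k j, 2 * (l - d j) * v l k j = c k j := by
    intro l hl k j
    have h := (hpos l hl j).ne'
    simp only [v]
    field_simp
  have hinv : ∀ j, Tendsto (fun l : ℝ => l - d j) atTop atTop := fun j =>
    tendsto_atTop_add_const_right _ _ tendsto_id
  rcases hε.eq_or_lt with rfl | hε
  -- With no budget `l` costs nothing, so a large `l` brings the dual value down to the primal value
  -- `0`.
  · have hb : Tendsto (fun l => M * ∑ k, b l k) atTop (𝓝 (M * ∑ _k : κ, ∑ _j : ι, (0 : ℝ))) := by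
      refine Tendsto.const_mul _ (tendsto_finsetSum _ fun k _ => tendsto_finsetSum _ fun j _ => ?_)
      exact Tendsto.const_div_atTop ((hinv j).const_mul_atTop (by norm_num)) _
    simp only [Finset.sum_const_zero, mul_zero] at hb
    obtain ⟨l, hl1, hl2⟩ := ((hb.eventually (gt_mem_nhds hδ)).and (eventually_gt_atTop (d j₀))).exists
    refine ⟨l, b l, 0, by linarith, hB l hl2, by simp, ?_⟩
    simpa using hl1.le
  -- So close to the top coefficient, spending the whole budget `ε²` along `j₀` loses at most `δ`.
  · set l₁ := d j₀ + δ / ε ^ 2 with hl₁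
    have hl₁' : d j₀ < l₁ := by
      have : 0 < δ / ε ^ 2 := by positivity
      linarith
    rcases le_or_gt (r l₁) (ε ^ 2) with h | h
    -- The hard case: the maximizers leave budget over. Shifting all of them by a common `t` along
    -- `j₀` uses it up.
    · set β := M * ∑ k, v l₁ k j₀ with hβ
      have hS : 0 ≤ β ^ 2 + (ε ^ 2 - r l₁) := by nlinarith [sq_nonneg β]
      -- Of the two roots, the one with `t * β ≥ 0` is taken; this forces `t² ≤ ε²`.
      obtain ⟨t, ht, htε⟩ : ∃ t : ℝ, r l₁ + 2 * t * β + t ^ 2 = ε ^ 2 ∧ t ^ 2 ≤ ε ^ 2 := by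
        have hr : 0 ≤ r l₁ := by positivity
        have hs := Real.sq_sqrt hS
        have hs0 := Real.sqrt_nonneg (β ^ 2 + (ε ^ 2 - r l₁))
        set q := √(β ^ 2 + (ε ^ 2 - r l₁))
        rcases le_total 0 β with hb | hb
        · have hq : β ≤ q := Real.le_sqrt_of_sq_le (by linarith)
          refine ⟨q - β, by nlinarith, ?_⟩
          nlinarith [mul_nonneg (sub_nonneg.2 hq) hb]
        · have hq : -β ≤ q := Real.le_sqrt_of_sq_le (by rw [neg_sq]; linarith)
          refine ⟨-q - β, by nlinarith, ?_⟩
          nlinarith [mul_nonneg (sub_nonneg.2 hq) (neg_nonneg.2 hb)]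
      let w : κ → ι → ℝ := fun k j => v l₁ k j + if j = j₀ then t else 0
      have hw2 : M * ∑ k, ∑ j, w k j ^ 2 = ε ^ 2 := by
        have : ∀ k, ∑ j, w k j ^ 2 = ∑ j, v l₁ k j ^ 2 + (2 * t * v l₁ k j₀ + t ^ 2) := by
          intro k
          have : ∀ j, w k j ^ 2 = v l₁ k j ^ 2 +
              if j = j₀ then (2 * t * v l₁ k j + t ^ 2) else 0 := by
            intro j
            simp only [w]
            split_ifs <;> ring
          simp [this, Finset.sum_add_distrib]
        simp only [this, Finset.sum_add_distrib, ← Finset.mul_sum, Finset.sum_const,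
          Finset.card_univ, nsmul_eq_mul]
        rw [← ht, hβ]
        linear_combination t ^ 2 * hM1
      have hwv : M * ∑ k, ∑ j, (c k j * w k j + d j * w k j ^ 2) =
          M * ∑ k, b l₁ k + l₁ * ε ^ 2 - (l₁ - d j₀) * t ^ 2 := by
        have : ∀ k, ∑ j, (c k j * w k j + d j * w k j ^ 2) =
            b l₁ k + l₁ * ∑ j, w k j ^ 2 - (l₁ - d j₀) * t ^ 2 := by
          intro k
          -- Stationarity of `v` cancels the terms linear in `t`, so only the quadratic loss
          -- remains.
          have : ∀ j, c k j * w k j + d j * w k j ^ 2 =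
              c k j ^ 2 / (4 * (l₁ - d j)) + l₁ * w k j ^ 2 -
                if j = j₀ then (l₁ - d j) * t ^ 2 else 0 := by
            intro j
            have h1 := hval l₁ hl₁' k j
            have h2 := hvc l₁ hl₁' k j
            simp only [w]
            split_ifs
            · linear_combination h1 - t * h2
            · linear_combination h1
          simp [this, Finset.sum_add_distrib, Finset.mul_sum, b]
        simp only [this, Finset.sum_add_distrib, Finset.sum_sub_distrib, ← Finset.mul_sum,
          Finset.sum_const, Finset.card_univ, nsmul_eq_mul]
        linear_combination l₁ * hw2 - (l₁ - d j₀) * t ^ 2 * hM1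
      refine ⟨l₁, b l₁, w, by linarith, hB l₁ hl₁', hw2.le, ?_⟩
      rw [hwv]
      have : (l₁ - d j₀) * t ^ 2 ≤ δ := by
        have : (l₁ - d j₀) * ε ^ 2 = δ := by rw [hl₁]; field_simp; ring
        nlinarith
      linarith
    -- The maximizers overspend at `l₁` but not for large `l`. Where the budget is met exactly,
    -- complementary slackness leaves no gap.
    · have hr : Tendsto r atTop (𝓝 (M * ∑ _k : κ, ∑ _j : ι, (0 : ℝ) ^ 2)) := by
        refine Tendsto.const_mul _ (tendsto_finsetSum _ fun k _ =>
          tendsto_finsetSum _ fun j _ => Tendsto.pow ?_ 2)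
        exact Tendsto.const_div_atTop ((hinv j).const_mul_atTop (by norm_num)) _
      simp only [ne_eq, OfNat.ofNat_ne_zero, not_false_eq_true, zero_pow, Finset.sum_const_zero,
        mul_zero] at hr
      obtain ⟨l₂, h2, hl₂⟩ := ((hr.eventually (gt_mem_nhds (pow_pos hε 2))).and
        (eventually_gt_atTop l₁)).exists
      have hcont : ContinuousOn r (Set.Icc l₁ l₂) := by
        refine continuousOn_const.mul (continuousOn_finsetSum _ fun k _ =>
          continuousOn_finsetSum _ fun j _ => ContinuousOn.pow (ContinuousOn.div continuousOn_const
            (by fun_prop) fun l hl => ?_) 2)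
        have := hpos l (hl₁'.trans_le hl.1) j
        positivity
      obtain ⟨l, hl, hrl⟩ := intermediate_value_Icc' hl₂.le hcont ⟨h2.le, h.le⟩
      have hl' : d j₀ < l := hl₁'.trans_le hl.1
      refine ⟨l, b l, v l, by linarith, hB l hl', hrl.le, ?_⟩
      simp only [hval l hl', Finset.sum_add_distrib, ← Finset.mul_sum]
      simp only [r] at hrl
      simp only [b]
      nlinarith

/-! ### Diagonalization of the quadratic costs -/

/-- A quadratic function on `ℝᵐ` is diagonalized by the orthogonal change of coordinates `R`. -/
def IsDiagonalized {m : ℕ} (R : EuclideanSpace ℝ (Fin m) ≃ₗᵢ[ℝ] EuclideanSpace ℝ (Fin m))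
    (d e : Fin m → ℝ) (h : EuclideanSpace ℝ (Fin m) → ℝ) : Prop :=
  ∀ ξ, h ξ = ∑ j, (d j * R ξ j ^ 2 + e j * R ξ j)

/-- `R` is `L` seen as an isometry and `e = L q`, since orthogonality gives `qᵀ ξ = (L q)ᵀ (L ξ)`.
-/
theorem exists_isDiagonalized {m : ℕ} {L : Matrix (Fin m) (Fin m) ℝ}
    (hL : L ∈ Matrix.orthogonalGroup (Fin m) ℝ) (d q : Fin m → ℝ) :
    ∃ R e, IsDiagonalized R d e (fun ξ : EuclideanSpace ℝ (Fin m) =>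
      (fun l => ξ l) ⬝ᵥ ((Lᵀ * Matrix.diagonal d * L) *ᵥ (fun l => ξ l)) +
        q ⬝ᵥ (fun l => ξ l)) := by
  have hU : Matrix.toEuclideanCLM (n := Fin m) (𝕜 := ℝ) L ∈
      unitary (EuclideanSpace ℝ (Fin m) →L[ℝ] EuclideanSpace ℝ (Fin m)) :=
    Unitary.map_mem (Matrix.toEuclideanCLM (n := Fin m) (𝕜 := ℝ)) hL
  refine ⟨Unitary.linearIsometryEquiv ⟨_, hU⟩, L *ᵥ q, fun ξ => ?_⟩
  have hR : ∀ j, Unitary.linearIsometryEquiv ⟨_, hU⟩ ξ j = (L *ᵥ (fun l => ξ l)) j :=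
    fun j => rfl
  simp only [hR, Finset.sum_add_distrib]
  have hLL : Lᵀ * L = 1 := (Matrix.mem_orthogonalGroup_iff' (Fin m) ℝ).1 hL
  congr 1
  · rw [← Matrix.mulVec_mulVec, ← Matrix.mulVec_mulVec, Matrix.dotProduct_mulVec,
      Matrix.vecMul_transpose]
    simp only [dotProduct, Matrix.mulVec_diagonal]
    exact Finset.sum_congr rfl fun j _ => by ring
  · change _ = (L *ᵥ q) ⬝ᵥ (L *ᵥ fun l => ξ l)
    rw [Matrix.dotProduct_mulVec, ← Matrix.mulVec_transpose, Matrix.mulVec_mulVec, hLL,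
      Matrix.one_mulVec]

namespace IsDiagonalized

variable {m : ℕ} {R : EuclideanSpace ℝ (Fin m) ≃ₗᵢ[ℝ] EuclideanSpace ℝ (Fin m)}
  {d e : Fin m → ℝ} {h : EuclideanSpace ℝ (Fin m) → ℝ}

theorem continuous (H : IsDiagonalized R d e h) : Continuous h := by
  rw [show h = _ from funext H]
  fun_prop

theorem norm_sq_eq (R : EuclideanSpace ℝ (Fin m) ≃ₗᵢ[ℝ] EuclideanSpace ℝ (Fin m))
    (u : EuclideanSpace ℝ (Fin m)) : ‖u‖ ^ 2 = ∑ j, R u j ^ 2 := by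
  rw [← R.norm_map, EuclideanSpace.real_norm_sq_eq]

/-- This growth bound supplies integrability in the second order weak duality. -/
theorem abs_le (H : IsDiagonalized R d e h) :
    ∃ C, ∀ ξ, |h ξ| ≤ C * (1 + ‖ξ‖ ^ 2) := by
  refine ⟨∑ j, (|d j| + |e j|), fun ξ => ?_⟩
  rw [H ξ, Finset.sum_mul]
  refine (Finset.abs_sum_le_sum_abs _ _).trans (Finset.sum_le_sum fun j _ => ?_)
  have h1 : R ξ j ^ 2 ≤ ‖ξ‖ ^ 2 := by
    rw [norm_sq_eq R]
    exact Finset.single_le_sum (f := fun j => R ξ j ^ 2) (fun _ _ => sq_nonneg _) (Finset.mem_univ j)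
  have h2 : |R ξ j| ≤ 1 + ‖ξ‖ ^ 2 := by
    nlinarith [sq_nonneg (|R ξ j| - 1), sq_abs (R ξ j)]
  refine (abs_add_le _ _).trans ?_
  rw [abs_mul, abs_mul, abs_of_nonneg (sq_nonneg (R ξ j)), add_mul]
  gcongr
  linarith

/-- Recentring at a sample changes only the linear coefficients, so all samples share the same `d`.
-/
theorem add_eq (H : IsDiagonalized R d e h) (s u : EuclideanSpace ℝ (Fin m)) :
    h (s + u) = h s + ∑ j, ((2 * d j * R s j + e j) * R u j + d j * R u j ^ 2) := by
  rw [H, H, ← Finset.sum_add_distrib]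
  refine Finset.sum_congr rfl fun j _ => ?_
  simp only [map_add, PiLp.add_apply]
  ring

/-- Near-strong duality between displacements of the points `s k` with averaged squared length at
most `ε ^ 2` and the penalized problems. -/
theorem exists_dual_gap_le (H : IsDiagonalized R d e h) (hd : Antitone d) (hd₀ : ∀ j, 0 ≤ d j)
    {K : ℕ} (hK : 0 < K) (s : Fin K → EuclideanSpace ℝ (Fin m))
    {ε δ : ℝ} (hε : 0 ≤ ε) (hδ : 0 < δ) :
    ∃ (l : ℝ) (B : Fin K → ℝ) (a : Fin K → EuclideanSpace ℝ (Fin m)), 0 ≤ l ∧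
      (∀ k ξ, h ξ - l * ‖ξ - s k‖ ^ 2 ≤ B k) ∧
      (K : ℝ)⁻¹ * ∑ k, ‖a k - s k‖ ^ 2 ≤ ε ^ 2 ∧
      l * ε ^ 2 + (K : ℝ)⁻¹ * ∑ k, B k ≤ (K : ℝ)⁻¹ * ∑ k, h (a k) + δ := by
  have : NeZero K := ⟨hK.ne'⟩
  -- In dimension zero there is no top coordinate; otherwise sorting makes it coordinate `0`.
  rcases Nat.eq_zero_or_pos m with rfl | hm
  · have h0 : ∀ ξ, h ξ = 0 := fun ξ => by simp [H ξ]
    exact ⟨0, 0, s, le_rfl, by simp [h0], by simp [sq_nonneg], by simp [h0, hδ.le]⟩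
  · obtain ⟨l, B, w, hl, hB, hw, hgap⟩ := _root_.exists_dual_gap_le
      (fun k j => 2 * d j * R (s k) j + e j) d ⟨0, hm⟩
      (fun j => hd (Fin.mk_le_of_le_val (Nat.zero_le _))) (hd₀ _) hε hδ
    simp only [Fintype.card_fin] at hw hgap
    refine ⟨l, fun k => h (s k) + B k, fun k => s k + R.symm (WithLp.toLp 2 (w k)), hl, ?_, ?_, ?_⟩
    · intro k ξ
      have h1 := H.add_eq (s k) (ξ - s k)
      rw [add_sub_cancel] at h1
      have h2 := hB k (R (ξ - s k))
      rw [Finset.sum_sub_distrib, ← Finset.mul_sum] at h2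
      rw [h1, norm_sq_eq R]
      linarith
    · simpa [EuclideanSpace.real_norm_sq_eq] using hw
    · simp only [H.add_eq, LinearIsometryEquiv.apply_symm_apply, Finset.sum_add_distrib,
        mul_add] at hgap ⊢
      linarith

/-- Quadratic growth along the coordinate direction `j`. -/
theorem exists_add_smul_eq (H : IsDiagonalized R d e h) (j : Fin m) :
    ∃ v : EuclideanSpace ℝ (Fin m), ‖v‖ = 1 ∧
      ∀ s, ∃ c, ∀ t : ℝ, h (s + t • v) = h s + (c * t + d j * t ^ 2) := by
  refine ⟨R.symm (EuclideanSpace.single j 1), by simp, fun s =>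
    ⟨2 * d j * R s j + e j, fun t => ?_⟩⟩
  rw [H.add_eq, Finset.sum_eq_single j]
  · simp
  · intro i _ hi
    simp [hi]
  · simp

end IsDiagonalized

/-! ### Wasserstein balls around empirical distributions -/

namespace DRGame

variable {m : ℕ}

theorem wasserstein_le_iff {p : ℕ} (hp : p ≠ 0) (μ ν : Measure (EuclideanSpace ℝ (Fin m))) {ε : ℝ}
    (hε : 0 ≤ ε) : wasserstein p μ ν ≤ ENNReal.ofReal ε ↔
      ⨅ π ∈ couplings μ ν, ∫⁻ z, ‖z.1 - z.2‖ₑ ^ p ∂π ≤ ENNReal.ofReal (ε ^ p) := by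
  have hp' : (0 : ℝ) < p := by positivity
  rw [wasserstein, one_div, ENNReal.rpow_inv_le_iff hp', ENNReal.rpow_natCast,
    ENNReal.ofReal_pow hε]

theorem expect_eq_integral {μ : Measure (EuclideanSpace ℝ (Fin m))}
    {h : EuclideanSpace ℝ (Fin m) → ℝ} (hh : Integrable h μ) :
    expect μ h = ((∫ ξ, h ξ ∂μ : ℝ) : EReal) := by
  have h1 : ∫⁻ ξ, ENNReal.ofReal (h ξ) ∂μ ≠ ⊤ := hh.lintegral_lt_top.ne
  have h2 : ∫⁻ ξ, ENNReal.ofReal (-h ξ) ∂μ ≠ ⊤ := hh.neg.lintegral_lt_top.ne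
  rw [integral_eq_lintegral_pos_part_sub_lintegral_neg_part hh, EReal.coe_sub,
    EReal.coe_ennreal_toReal h1, EReal.coe_ennreal_toReal h2, expect]

section Discrete

variable {α β ι : Type*} [MeasurableSpace α] [MeasurableSpace β] [Fintype ι]

theorem map_sum_smul_dirac (w : ι → ℝ≥0∞) (a : ι → α) {f : α → β} (hf : Measurable f) :
    (∑ i, w i • Measure.dirac (a i)).map f = ∑ i, w i • Measure.dirac (f (a i)) := by
  rw [Measure.map_finset_sum hf.aemeasurable]
  simp [Measure.map_smul, Measure.map_dirac' hf]

theorem integrable_sum_smul_dirac [MeasurableSingletonClass α] {w : ι → ℝ≥0∞}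
    (hw : ∀ i, w i ≠ ⊤) (a : ι → α) (h : α → ℝ) :
    Integrable h (∑ i, w i • Measure.dirac (a i)) :=
  integrable_finsetSum_measure.2 fun i _ => (integrable_dirac (by simp)).smul_measure (hw i)

theorem integral_sum_smul_dirac [MeasurableSingletonClass α] {w : ι → ℝ≥0∞}
    (hw : ∀ i, w i ≠ ⊤) (a : ι → α) (h : α → ℝ) :
    ∫ x, h x ∂(∑ i, w i • Measure.dirac (a i)) = ∑ i, (w i).toReal * h (a i) := by
  rw [integral_finsetSum_measure fun i _ => (integrable_dirac (by simp)).smul_measure (hw i)]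
  simp [integral_smul_measure]

end Discrete

/-- Moving the atoms of a discrete measure costs at most the weighted sum of the displacements. -/
theorem wasserstein_sum_dirac_le {ι : Type*} [Fintype ι] {p : ℕ} (hp : p ≠ 0) {w : ι → ℝ}
    (hw : ∀ i, 0 ≤ w i) (a b : ι → EuclideanSpace ℝ (Fin m)) {ε : ℝ} (hε : 0 ≤ ε)
    (hc : ∑ i, w i * ‖a i - b i‖ ^ p ≤ ε ^ p) :
    wasserstein p (∑ i, ENNReal.ofReal (w i) • Measure.dirac (a i))
      (∑ i, ENNReal.ofReal (w i) • Measure.dirac (b i)) ≤ ENNReal.ofReal ε := by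
  rw [wasserstein_le_iff hp _ _ hε]
  refine (iInf₂_le (∑ i, ENNReal.ofReal (w i) • Measure.dirac (a i, b i))
    ⟨map_sum_smul_dirac _ _ measurable_fst, map_sum_smul_dirac _ _ measurable_snd⟩).trans ?_
  rw [lintegral_finsetSum_measure]
  simp only [lintegral_smul_measure, lintegral_dirac, smul_eq_mul]
  refine le_trans (le_of_eq ?_) (ENNReal.ofReal_le_ofReal hc)
  rw [ENNReal.ofReal_sum_of_nonneg fun i _ => mul_nonneg (hw i) (by positivity)]
  refine Finset.sum_congr rfl fun i _ => ?_
  rw [ENNReal.ofReal_mul (hw i), ENNReal.ofReal_pow (norm_nonneg _), ofReal_norm]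

theorem empirical_eq_sum {K : ℕ} (hK : 0 < K) (s : Fin K → EuclideanSpace ℝ (Fin m)) :
    empirical s = ∑ k, ENNReal.ofReal (K : ℝ)⁻¹ • Measure.dirac (s k) := by
  rw [empirical, Finset.smul_sum, ENNReal.ofReal_inv_of_pos (by positivity), ENNReal.ofReal_natCast]

theorem integrable_empirical {K : ℕ} (hK : 0 < K) (s : Fin K → EuclideanSpace ℝ (Fin m))
    (h : EuclideanSpace ℝ (Fin m) → ℝ) : Integrable h (empirical s) := by
  rw [empirical_eq_sum hK]
  exact integrable_sum_smul_dirac (fun _ => ENNReal.ofReal_ne_top) _ _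

theorem integral_empirical {K : ℕ} (hK : 0 < K) (s : Fin K → EuclideanSpace ℝ (Fin m))
    (h : EuclideanSpace ℝ (Fin m) → ℝ) :
    ∫ ξ, h ξ ∂empirical s = (K : ℝ)⁻¹ * ∑ k, h (s k) := by
  rw [empirical_eq_sum hK, integral_sum_smul_dirac (fun _ => ENNReal.ofReal_ne_top), Finset.mul_sum]
  simp

theorem ae_empirical_mem {K : ℕ} (s : Fin K → EuclideanSpace ℝ (Fin m)) :
    ∀ᵐ ξ ∂empirical s, ξ ∈ Set.range s := by
  rw [empirical]
  refine Measure.ae_smul_measure ?_ _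
  simp

/-- Weak duality over a Wasserstein ball. -/
theorem expect_le_of_wasserstein_le {p : ℕ} (hp : p ≠ 0) {K : ℕ} (hK : 0 < K)
    {s : Fin K → EuclideanSpace ℝ (Fin m)} {μ : Measure (EuclideanSpace ℝ (Fin m))}
    [IsProbabilityMeasure μ] {ε : ℝ} (hε : 0 ≤ ε)
    (hμ : wasserstein p μ (empirical s) ≤ ENNReal.ofReal ε)
    {h Φ : EuclideanSpace ℝ (Fin m) → ℝ} (hcont : Continuous h) {C : ℝ}
    (hC : ∀ ξ, |h ξ| ≤ C * (1 + ‖ξ‖ ^ p)) {l : ℝ} (hl : 0 ≤ l)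
    (hΦ : ∀ k ξ, h ξ ≤ Φ (s k) + l * ‖ξ - s k‖ ^ p) :
    expect μ h ≤ ((l * ε ^ p + (K : ℝ)⁻¹ * ∑ k, Φ (s k) : ℝ) : EReal) := by
  rw [wasserstein_le_iff hp _ _ hε] at hμ
  have hC0 : 0 ≤ C := by
    have h0 := (abs_nonneg _).trans (hC 0)
    exact nonneg_of_mul_nonneg_left h0 (by positivity)
  -- No optimal coupling is needed: a coupling within `δ` of the budget suffices, and `δ → 0` at the
  -- end.
  have key : ∀ δ : ℝ, 0 < δ → Integrable h μ ∧
      ∫ ξ, h ξ ∂μ ≤ l * (ε ^ p + δ) + (K : ℝ)⁻¹ * ∑ k, Φ (s k) := by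
    intro δ hδ
    have hlt : ⨅ π ∈ couplings μ (empirical s), ∫⁻ z, ‖z.1 - z.2‖ₑ ^ p ∂π <
        ENNReal.ofReal (ε ^ p + δ) :=
      hμ.trans_lt ((ENNReal.ofReal_lt_ofReal_iff (by positivity)).2 (by linarith))
    simp only [iInf_lt_iff] at hlt
    obtain ⟨π, ⟨hπ1, hπ2⟩, hπ⟩ := hlt
    have : IsProbabilityMeasure π := by
      rw [← hπ1] at ‹IsProbabilityMeasure μ›
      exact (Measure.isProbabilityMeasure_map_iff measurable_fst.aemeasurable).1 ‹_›
    -- The second marginal has finite support, so `F`, and hence `Φ`, needs no regularity.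
    have hsnd : ∀ F : EuclideanSpace ℝ (Fin m) → ℝ, Integrable (fun z => F z.2) π := fun F => by
      have hF := integrable_empirical hK s F
      rw [← hπ2] at hF
      exact hF.comp_measurable measurable_snd
    have hcost : Integrable (fun z : EuclideanSpace ℝ (Fin m) × EuclideanSpace ℝ (Fin m) =>
        ‖z.1 - z.2‖ ^ p) π := by
      refine ⟨by fun_prop, ?_⟩
      simp only [HasFiniteIntegral, enorm_pow, enorm_norm]
      exact hπ.trans ENNReal.ofReal_lt_top
    have hint : Integrable (fun z : EuclideanSpace ℝ (Fin m) × EuclideanSpace ℝ (Fin m) =>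
        h z.1) π := by
      refine Integrable.mono' (g := fun z => C * (1 + 2 ^ (p - 1) * (‖z.1 - z.2‖ ^ p + ‖z.2‖ ^ p)))
        ?_ (by fun_prop) (ae_of_all _ fun z => ?_)
      · exact ((integrable_const _).add ((hcost.add (hsnd fun ξ => ‖ξ‖ ^ p)).const_mul _)).const_mul _
      · refine (hC z.1).trans ?_
        gcongr
        refine le_trans ?_ (add_pow_le (norm_nonneg _) (norm_nonneg _) p)
        gcongr
        simpa using norm_add_le (z.1 - z.2) z.2
    have hcost_le : ∫ z, ‖z.1 - z.2‖ ^ p ∂π ≤ ε ^ p + δ := by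
      rw [integral_eq_lintegral_of_nonneg_ae (ae_of_all _ fun z => by positivity) (by fun_prop)]
      refine ENNReal.toReal_le_of_le_ofReal (by positivity) (le_trans (le_of_eq ?_) hπ.le)
      refine lintegral_congr fun z => ?_
      rw [ENNReal.ofReal_pow (norm_nonneg _), ofReal_norm]
    have hint' : Integrable h μ := by
      rw [← hπ1]
      exact (integrable_map_measure (by fun_prop) measurable_fst.aemeasurable).2 hint
    refine ⟨hint', ?_⟩
    have hmem : ∀ᵐ z ∂π, z.2 ∈ Set.range s := by
      have h1 := ae_empirical_mem s
      rw [← hπ2] at h1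
      exact ae_of_ae_map measurable_snd.aemeasurable h1
    calc ∫ ξ, h ξ ∂μ = ∫ z, h z.1 ∂π := by
          rw [← hπ1, integral_map measurable_fst.aemeasurable (by fun_prop)]
      _ ≤ ∫ z, (Φ z.2 + l * ‖z.1 - z.2‖ ^ p) ∂π := by
          refine integral_mono_ae hint ((hsnd Φ).add (hcost.const_mul l)) ?_
          filter_upwards [hmem] with z hz
          obtain ⟨k, hk⟩ := hz
          simpa [hk] using hΦ k z.1
      _ = (K : ℝ)⁻¹ * ∑ k, Φ (s k) + l * ∫ z, ‖z.1 - z.2‖ ^ p ∂π := by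
          rw [integral_add (hsnd Φ) (hcost.const_mul l), integral_const_mul, ← integral_empirical hK,
            ← hπ2, integral_map measurable_snd.aemeasurable]
          rw [hπ2]
          exact (integrable_empirical hK s Φ).aestronglyMeasurable
      _ ≤ l * (ε ^ p + δ) + (K : ℝ)⁻¹ * ∑ k, Φ (s k) := by
          have := mul_le_mul_of_nonneg_left hcost_le hl
          linarith
  rw [expect_eq_integral (key 1 one_pos).1, EReal.coe_le_coe_iff]
  have hlim : Tendsto (fun δ : ℝ => l * (ε ^ p + δ) + (K : ℝ)⁻¹ * ∑ k, Φ (s k)) (𝓝[>] 0)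
      (𝓝 (l * (ε ^ p + 0) + (K : ℝ)⁻¹ * ∑ k, Φ (s k))) :=
    Tendsto.mono_left (Continuous.tendsto (by fun_prop) 0) nhdsWithin_le_nhds
  rw [add_zero] at hlim
  exact ge_of_tendsto hlim (eventually_mem_nhdsWithin.mono fun δ hδ => (key δ hδ).2)

/-- A measure at first order distance zero from an empirical distribution is at second order
distance zero from it. -/
theorem wasserstein_two_le_zero {K : ℕ} (hK : 0 < K)
    {s : Fin K → EuclideanSpace ℝ (Fin m)} {μ : Measure (EuclideanSpace ℝ (Fin m))}
    (hμ : wasserstein 1 μ (empirical s) ≤ ENNReal.ofReal 0) :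
    wasserstein 2 μ (empirical s) ≤ ENNReal.ofReal 0 := by
  rw [wasserstein_le_iff one_ne_zero _ _ le_rfl] at hμ
  rw [wasserstein_le_iff two_ne_zero _ _ le_rfl]
  simp only [pow_one, ne_eq, OfNat.ofNat_ne_zero, not_false_eq_true, zero_pow, ENNReal.ofReal_zero,
    nonpos_iff_eq_zero] at hμ ⊢
  have : Nonempty (Fin K) := ⟨⟨0, hK⟩⟩
  have hfin : (Set.range s).Finite := Set.finite_range s
  have hsnd : ∀ π ∈ couplings μ (empirical s), ∀ᵐ z ∂π, z.2 ∈ Set.range s := fun π hπ => by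
    have h1 := ae_empirical_mem s
    rw [← hπ.2] at h1
    exact ae_of_ae_map measurable_snd.aemeasurable h1
  have hmem : ∀ᵐ ξ ∂μ, ξ ∈ Set.range s := by
    -- The mean distance to the sample set is at most the cost of every coupling, so `μ` lives on
    -- the samples.
    have h0 : ∫⁻ ξ, Metric.infEDist ξ (Set.range s) ∂μ = 0 := by
      refine le_antisymm (hμ ▸ le_iInf₂ fun π hπ => ?_) bot_le
      rw [← hπ.1, lintegral_map (by fun_prop) measurable_fst]
      refine lintegral_mono_ae ?_
      filter_upwards [hsnd π hπ] with z hz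
      rw [← edist_eq_enorm_sub]
      exact Metric.infEDist_le_edist_of_mem hz
    rw [lintegral_eq_zero_iff (by fun_prop)] at h0
    filter_upwards [h0] with ξ hξ
    exact (Metric.mem_iff_infEDist_zero_of_closed hfin.isClosed).2 hξ
  obtain ⟨D, hD0, hD⟩ : ∃ D : ℝ, 0 < D ∧ ∀ ξ ∈ Set.range s, ∀ ζ ∈ Set.range s, dist ξ ζ ≤ D := by
    obtain ⟨D, hD⟩ := Metric.isBounded_iff.1 hfin.isBounded
    -- The maximum with `1` keeps the factor nonzero, so that it can be pulled out of the infimum.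
    exact ⟨max D 1, by positivity, fun ξ hξ ζ hζ => (hD hξ hζ).trans (le_max_left _ _)⟩
  have hle : ∀ π ∈ couplings μ (empirical s), ∫⁻ z, ‖z.1 - z.2‖ₑ ^ 2 ∂π ≤
      ENNReal.ofReal D * ∫⁻ z, ‖z.1 - z.2‖ₑ ∂π := fun π hπ => by
    rw [← lintegral_const_mul _ (by fun_prop)]
    refine lintegral_mono_ae ?_
    rw [← hπ.1] at hmem
    filter_upwards [hsnd π hπ, ae_of_ae_map measurable_fst.aemeasurable hmem] with z h2 h1
    rw [sq, ← ofReal_norm, ← dist_eq_norm]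
    gcongr
    exact hD _ h1 _ h2
  refine le_antisymm ?_ bot_le
  calc ⨅ π ∈ couplings μ (empirical s), ∫⁻ z, ‖z.1 - z.2‖ₑ ^ 2 ∂π
      ≤ ⨅ π ∈ couplings μ (empirical s), ENNReal.ofReal D * ∫⁻ z, ‖z.1 - z.2‖ₑ ∂π :=
        iInf₂_mono hle
    _ = ENNReal.ofReal D * ⨅ π ∈ couplings μ (empirical s), ∫⁻ z, ‖z.1 - z.2‖ₑ ∂π := by
        simp only [ENNReal.mul_iInf_of_ne (ENNReal.ofReal_pos.2 hD0).ne' ENNReal.ofReal_ne_top]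
    _ = 0 := by rw [hμ, mul_zero]

end DRGame

/-! ### Worst-case cost versus dual cost -/

namespace DRGame

theorem ereal_coe_sum {ι : Type*} (s : Finset ι) (F : ι → ℝ) :
    ((∑ i ∈ s, F i : ℝ) : EReal) = ∑ i ∈ s, (F i : EReal) :=
  map_sum (⟨⟨Real.toEReal, EReal.coe_zero⟩, EReal.coe_add⟩ : ℝ →+ EReal) F s

variable {N n m : ℕ} (G : DRGame N n m) (i : Fin N)
  (x : Fin N → EuclideanSpace ℝ (Fin n))

/-- A discrete measure obtained by splitting and moving the atoms of the empirical distribution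
bounds the worst case from below. -/
theorem le_worstCase {ι : Type*} [Fintype ι] {p : ℕ} (hp : p ≠ 0) {w : ι → ℝ} (hw : ∀ j, 0 ≤ w j)
    (a b : ι → EuclideanSpace ℝ (Fin m))
    (hb : ∑ j, ENNReal.ofReal (w j) • Measure.dirac (b j) = empirical (G.sample i))
    (hc : ∑ j, w j * ‖a j - b j‖ ^ p ≤ G.ε i ^ p) :
    ((G.f i x + ∑ j, w j * G.g i x (a j) : ℝ) : EReal) ≤ G.worstCase p i x := by
  have hmem : ∑ j, ENNReal.ofReal (w j) • Measure.dirac (a j) ∈ G.ambiguitySet p i := by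
    refine ⟨⟨?_⟩, ?_⟩
    · have h := congrArg (fun μ => μ Set.univ) hb
      simp only [Measure.coe_finsetSum, Finset.sum_apply, Measure.smul_apply, measure_univ,
        empirical] at h ⊢
      rw [h]
      simp only [Finset.sum_const, Finset.card_univ, Fintype.card_fin, nsmul_eq_mul, mul_one,
        smul_eq_mul]
      exact ENNReal.inv_mul_cancel (by exact_mod_cast (G.K_pos i).ne') (ENNReal.natCast_ne_top _)
    · rw [← hb]
      exact wasserstein_sum_dirac_le hp hw a b (G.ε_nonneg i) hc
  refine le_trans (le_of_eq ?_) (le_iSup₂_of_le _ hmem le_rfl)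
  rw [expect_eq_integral (integrable_sum_smul_dirac (fun _ => ENNReal.ofReal_ne_top) _ _),
    integral_sum_smul_dirac (fun _ => ENNReal.ofReal_ne_top), EReal.coe_add]
  simp only [ENNReal.toReal_ofReal (hw _)]

/-- For `p = 1`, Cauchy-Schwarz bounds the mean displacement by the root mean square, so the second
order budget is enough. -/
theorem le_worstCase_of_displacement {p : ℕ} (hp : p = 1 ∨ p = 2)
    (a : Fin (G.K i) → EuclideanSpace ℝ (Fin m))
    (hc : (G.K i : ℝ)⁻¹ * ∑ k, ‖a k - G.sample i k‖ ^ 2 ≤ G.ε i ^ 2) :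
    ((G.f i x + (G.K i : ℝ)⁻¹ * ∑ k, G.g i x (a k) : ℝ) : EReal) ≤ G.worstCase p i x := by
  rw [Finset.mul_sum]
  refine G.le_worstCase i x (by omega) (fun _ => by positivity) a (G.sample i)
    (empirical_eq_sum (G.K_pos i) _).symm ?_
  rw [← Finset.mul_sum]
  rcases hp with rfl | rfl
  · simp only [pow_one]
    refine abs_le_of_sq_le_sq' ?_ (G.ε_nonneg i) |>.2
    have hK : (0 : ℝ) < G.K i := by exact_mod_cast G.K_pos i
    have h := sq_sum_le_card_mul_sum_sq (s := Finset.univ) (f := fun k => ‖a k - G.sample i k‖)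
    rw [Finset.card_univ, Fintype.card_fin] at h
    refine le_trans ?_ hc
    rw [mul_pow, sq (G.K i : ℝ)⁻¹, mul_assoc]
    gcongr
    rwa [inv_mul_le_iff₀ hK]
  · exact hc

theorem J_le {l : ℝ} {B : Fin (G.K i) → ℝ}
    (hB : ∀ k ξ, G.g i x ξ - l * ‖ξ - G.sample i k‖ ^ 2 ≤ B k) :
    G.J i x l ≤ ((G.f i x + l * G.ε i ^ 2 + (G.K i : ℝ)⁻¹ * ∑ k, B k : ℝ) : EReal) := by
  rw [EReal.coe_add, EReal.coe_mul, ereal_coe_sum, J]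
  gcongr
  exact iSup_le fun ξ => EReal.coe_le_coe_iff.2 (hB _ ξ)

theorem le_J (l : ℝ) (a : Fin (G.K i) → EuclideanSpace ℝ (Fin m)) :
    ((G.f i x + l * G.ε i ^ 2 + (G.K i : ℝ)⁻¹ *
      ∑ k, (G.g i x (a k) - l * ‖a k - G.sample i k‖ ^ 2) : ℝ) : EReal) ≤ G.J i x l := by
  rw [EReal.coe_add, EReal.coe_mul, ereal_coe_sum, J]
  gcongr with k
  exact le_iSup (fun ξ => ((G.g i x ξ - l * ‖ξ - G.sample i k‖ ^ 2 : ℝ) : EReal)) _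

theorem worstCase_le {p : ℕ} {c : ℝ}
    (h : ∀ μ ∈ G.ambiguitySet p i, expect μ (G.g i x) ≤ c) :
    G.worstCase p i x ≤ ((G.f i x + c : ℝ) : EReal) := by
  refine iSup₂_le fun μ hμ => ?_
  rw [EReal.coe_add]
  gcongr
  exact h μ hμ

/-- When `J` is finite, its inner suprema are real and serve as `Φ` in
`expect_le_of_wasserstein_le`. -/
theorem worstCase_two_le_J (hcont : Continuous (G.g i x)) {C : ℝ}
    (hC : ∀ ξ, |G.g i x ξ| ≤ C * (1 + ‖ξ‖ ^ 2)) {l : ℝ} (hl : 0 ≤ l) :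
    G.worstCase 2 i x ≤ G.J i x l := by
  by_cases htop : G.J i x l = ⊤
  · rw [htop]
    exact le_top
  have hK : (0 : ℝ) < G.K i := by exact_mod_cast G.K_pos i
  let F : EuclideanSpace ℝ (Fin m) → EuclideanSpace ℝ (Fin m) → ℝ := fun z ξ =>
    G.g i x ξ - l * ‖ξ - z‖ ^ 2
  have hbot : ∀ z, ⨆ ξ, (F z ξ : EReal) ≠ ⊥ := fun z =>
    ne_bot_of_le_ne_bot (EReal.coe_ne_bot (F z z)) (le_iSup (fun ξ => (F z ξ : EReal)) z)
  -- Keeping all other points at their samples bounds the other summands of `J` from below, so one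
  -- infinite supremum would make `J` infinite.
  have hfin : ∀ k, ⨆ ξ, (F (G.sample i k) ξ : EReal) ≠ ⊤ := by
    intro k
    obtain ⟨c, hc⟩ := EReal.lt_iff_exists_real_btwn.1 (lt_top_iff_ne_top.2 htop)
    have hle : ∀ ξ, F (G.sample i k) ξ ≤ (c - (G.f i x + l * G.ε i ^ 2)) * G.K i -
        ∑ k' ∈ Finset.univ.erase k, F (G.sample i k') (G.sample i k') := by
      intro ξ
      have h := EReal.coe_le_coe_iff.1
        ((G.le_J i x l (Function.update (G.sample i) k ξ)).trans hc.1.le)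
      rw [← Finset.add_sum_erase _ _ (Finset.mem_univ k), Function.update_self,
        Finset.sum_congr rfl (g := fun k' => F (G.sample i k') (G.sample i k')) fun k' hk' => by
          rw [Function.update_of_ne (Finset.ne_of_mem_erase hk')]] at h
      rw [← le_sub_iff_add_le', inv_mul_le_iff₀ hK] at h
      simp only [F] at h ⊢
      linarith
    exact ne_top_of_le_ne_top (EReal.coe_ne_top _)
      (iSup_le fun ξ => EReal.coe_le_coe_iff.2 (hle ξ))
  -- Away from the samples `toReal` may return its default value; only the values at samples are
  -- used.
  let Φ : EuclideanSpace ℝ (Fin m) → ℝ := fun z => (⨆ ξ, (F z ξ : EReal)).toReal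
  have hΦ : ∀ k, (Φ (G.sample i k) : EReal) = ⨆ ξ, (F (G.sample i k) ξ : EReal) := fun k =>
    EReal.coe_toReal (hfin k) (hbot _)
  have hJ : G.J i x l = ((G.f i x + (l * G.ε i ^ 2 + (G.K i : ℝ)⁻¹ * ∑ k, Φ (G.sample i k)) : ℝ) :
      EReal) := by
    rw [← add_assoc, EReal.coe_add, EReal.coe_mul, ereal_coe_sum, J]
    simp only [hΦ, F]
  rw [hJ]
  refine G.worstCase_le i x fun μ hμ => ?_
  have := hμ.1
  refine expect_le_of_wasserstein_le two_ne_zero (G.K_pos i) (G.ε_nonneg i) hμ.2 hcont hC hl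
    fun k ξ => ?_
  have h : (F (G.sample i k) ξ : EReal) ≤ Φ (G.sample i k) := by
    rw [hΦ]
    exact le_iSup (fun ξ => (F (G.sample i k) ξ : EReal)) ξ
  have := EReal.coe_le_coe_iff.1 h
  simp only [F] at this
  linarith

/-- For a linear cost with slope `q`, the worst case adds at most `‖q‖ * ε` to the empirical mean.
Shifting every sample by `u`, of length at most `ε` and aligned with `q`, earns as much in `J`, and
the penalty is absorbed by `l * ε²`. -/
theorem worstCase_one_le_J_of_eq_zero (hQ : G.Q i = 0) {l : ℝ} (hl : 0 ≤ l) :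
    G.worstCase 1 i x ≤ G.J i x l := by
  obtain ⟨q, hg⟩ : ∃ q : EuclideanSpace ℝ (Fin m), ∀ ξ, G.g i x ξ = inner ℝ q ξ :=
    ⟨WithLp.toLp 2 (G.P i x), fun ξ => by
      simp [g, hQ, PiLp.inner_apply, dotProduct, mul_comm]⟩
  have hε := G.ε_nonneg i
  have hK : (0 : ℝ) < G.K i := by exact_mod_cast G.K_pos i
  obtain ⟨u, hu, hqu⟩ : ∃ u : EuclideanSpace ℝ (Fin m), ‖u‖ ≤ G.ε i ∧
      inner ℝ q u = ‖q‖ * G.ε i := by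
    rcases eq_or_ne q 0 with rfl | hq
    · exact ⟨0, by simpa using hε, by simp⟩
    · have hq' : ‖q‖ ≠ 0 := norm_ne_zero_iff.2 hq
      refine ⟨(G.ε i / ‖q‖) • q, le_of_eq ?_, ?_⟩
      · rw [norm_smul, Real.norm_of_nonneg (by positivity)]
        field_simp
      · rw [inner_smul_right, real_inner_self_eq_norm_sq]
        field_simp
  have hworst : G.worstCase 1 i x ≤ ((G.f i x + (‖q‖ * G.ε i ^ 1 +
      (G.K i : ℝ)⁻¹ * ∑ k, G.g i x (G.sample i k)) : ℝ) : EReal) := by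
    refine G.worstCase_le i x fun μ hμ => ?_
    have := hμ.1
    -- The first order multiplier is the Lipschitz constant `‖q‖`, unrelated to `l`.
    refine expect_le_of_wasserstein_le one_ne_zero (G.K_pos i) hε hμ.2 ?_ (C := ‖q‖)
      (fun ξ => ?_) (norm_nonneg q) fun k ξ => ?_
    · rw [show G.g i x = _ from funext hg]
      fun_prop
    · rw [hg, pow_one]
      refine (abs_real_inner_le_norm q ξ).trans ?_
      nlinarith [norm_nonneg q]
    · rw [pow_one, hg, hg, ← sub_le_iff_le_add', ← inner_sub_right]
      exact real_inner_le_norm _ _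
  refine (hworst.trans (EReal.coe_le_coe_iff.2 ?_)).trans
    (G.le_J i x l fun k => G.sample i k + u)
  simp only [hg, inner_add_right, add_sub_cancel_left, hqu, Finset.sum_sub_distrib,
    Finset.sum_add_distrib, Finset.sum_const, Finset.card_univ, Fintype.card_fin, nsmul_eq_mul]
  have h1 : l * ‖u‖ ^ 2 ≤ l * G.ε i ^ 2 := by gcongr
  have h2 : (G.K i : ℝ)⁻¹ * G.K i = 1 := inv_mul_cancel₀ hK.ne'
  rw [mul_sub, mul_add, ← mul_assoc, h2, ← mul_assoc _ _ (l * _), h2]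
  linarith

/-- A first order Wasserstein ball of positive radius contains measures with arbitrarily large
expectation of a function that grows quadratically in some direction. -/
theorem worstCase_one_eq_top (hε : 0 < G.ε i) {v : EuclideanSpace ℝ (Fin m)} (hv : ‖v‖ = 1)
    {r : ℝ} (hr : 0 < r)
    (hg : ∀ s, ∃ c, ∀ t : ℝ, G.g i x (s + t • v) = G.g i x s + (c * t + r * t ^ 2)) :
    G.worstCase 1 i x = ⊤ := by
  choose c hc using hg
  have hK : (0 : ℝ) < G.K i := by exact_mod_cast G.K_pos i
  have hK1 : (G.K i : ℝ)⁻¹ * G.K i = 1 := inv_mul_cancel₀ hK.ne'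
  have key : ∀ t, G.ε i ≤ t → ((G.f i x + ((G.K i : ℝ)⁻¹ * ∑ k, (G.g i x (G.sample i k) +
      G.ε i * c (G.sample i k)) + G.ε i * r * t) : ℝ) : EReal) ≤ G.worstCase 1 i x := by
    intro t ht
    have ht0 : 0 < t := hε.trans_le ht
    have hα : G.ε i / t ≤ 1 := (div_le_one ht0).2 ht
    have hα0 : 0 < G.ε i / t := by positivity
    -- A fraction `ε / t` of each atom travels distance `t`: the transport cost is exactly `ε`,
    -- while the quadratic term gains `ε * r * t`.
    refine le_trans (le_of_eq ?_) (G.le_worstCase i x one_ne_zero (ι := Fin (G.K i) × Bool)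
      (w := fun z => (G.K i : ℝ)⁻¹ * if z.2 then G.ε i / t else 1 - G.ε i / t) ?_
      (fun z => if z.2 then G.sample i z.1 + t • v else G.sample i z.1)
      (fun z => G.sample i z.1) ?_ ?_)
    · congr 2
      simp only [Fintype.sum_prod_type, Fintype.sum_bool, if_true, Bool.false_eq_true, if_false, hc]
      have : G.ε i * r * t = (G.K i : ℝ)⁻¹ * ∑ _k : Fin (G.K i), G.ε i * r * t := by
        rw [Finset.sum_const, Finset.card_univ, Fintype.card_fin, nsmul_eq_mul, ← mul_assoc, hK1,
          one_mul]
      rw [this, ← mul_add, ← Finset.sum_add_distrib, Finset.mul_sum]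
      refine Finset.sum_congr rfl fun k _ => ?_
      field_simp
      ring
    · intro z
      refine mul_nonneg (by positivity) ?_
      split_ifs <;> linarith
    · rw [empirical_eq_sum (G.K_pos i), Fintype.sum_prod_type]
      refine Finset.sum_congr rfl fun k _ => ?_
      simp only [Fintype.sum_bool, if_true, Bool.false_eq_true, if_false]
      rw [← add_smul, ← ENNReal.ofReal_add (by positivity)
        (mul_nonneg (by positivity) (by linarith)), ← mul_add, add_sub_cancel, mul_one]
    · simp only [Fintype.sum_prod_type, Fintype.sum_bool, if_true, Bool.false_eq_true, if_false,
        add_sub_cancel_left, sub_self, norm_zero, pow_one, mul_zero, add_zero, norm_smul, hv,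
        Real.norm_of_nonneg ht0.le, mul_one, Finset.sum_const, Finset.card_univ, Fintype.card_fin,
        nsmul_eq_mul]
      refine le_of_eq ?_
      field_simp
  refine (EReal.eq_top_iff_forall_lt _).2 fun y => ?_
  have hlim : Tendsto (fun t => G.f i x + ((G.K i : ℝ)⁻¹ * ∑ k, (G.g i x (G.sample i k) +
      G.ε i * c (G.sample i k)) + G.ε i * r * t)) atTop atTop :=
    tendsto_atTop_add_const_left _ _ (tendsto_atTop_add_const_left _ _
      (tendsto_id.const_mul_atTop (by positivity)))
  obtain ⟨t, hty, ht⟩ := ((hlim.eventually_gt_atTop y).and (eventually_ge_atTop (G.ε i))).exists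
  exact (EReal.coe_lt_coe_iff.2 hty).trans_le (key t ht)

theorem exists_isDiagonalized_g (hQ : G.QuadraticForms) :
    ∃ d : Fin m → ℝ, Antitone d ∧ (∀ j, 0 ≤ d j) ∧ (d = 0 → G.Q i = 0) ∧
      ∀ x, ∃ R e, IsDiagonalized R d e (G.g i x) := by
  obtain ⟨L, hL, d, hd, hd0, hQL⟩ := hQ i
  refine ⟨d, hd, hd0, fun h => by simp [hQL, h], fun x => ?_⟩
  obtain ⟨R, e, H⟩ := exists_isDiagonalized hL d (G.P i x)
  refine ⟨R, e, fun ξ => ?_⟩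
  rw [← H ξ, ← hQL, g]

/-- Minimizing over the multiplier closes the duality gap. -/
theorem le_worstCase_of_forall_le_J (hQ : G.QuadraticForms) {p : ℕ} (hp : p = 1 ∨ p = 2)
    {b : EReal} (h : ∀ l, 0 ≤ l → b ≤ G.J i x l) : b ≤ G.worstCase p i x := by
  obtain ⟨d, hd, hd0, -, H⟩ := G.exists_isDiagonalized_g i hQ
  obtain ⟨R, e, H⟩ := H x
  by_contra! hlt
  obtain ⟨c, hc, hcb⟩ := EReal.lt_iff_exists_real_btwn.1 hlt
  -- Two reals strictly between the bounds give a real positive `δ = c' - c`, even if `b = ⊤`.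
  obtain ⟨c', hc', hcb'⟩ := EReal.lt_iff_exists_real_btwn.1 hcb
  have hδ : 0 < c' - c := sub_pos.2 (EReal.coe_lt_coe_iff.1 hc')
  obtain ⟨l, B, a, hl, hB, ha, hgap⟩ := H.exists_dual_gap_le hd hd0 (G.K_pos i) (G.sample i)
    (G.ε_nonneg i) hδ
  have h1 := EReal.coe_lt_coe_iff.1 ((G.le_worstCase_of_displacement i x hp a ha).trans_lt hc)
  have h2 := EReal.coe_lt_coe_iff.1 (hcb'.trans_le ((h l hl).trans (G.J_le i x hB)))
  linarith

/-- Weak duality in the game, unless the first order worst case is identically infinite. -/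
theorem worstCase_le_J_or_eq_top (hQ : G.QuadraticForms) {p : ℕ} (hp : p = 1 ∨ p = 2) :
    (∀ x l, 0 ≤ l → G.worstCase p i x ≤ G.J i x l) ∨ ∀ x, G.worstCase p i x = ⊤ := by
  obtain ⟨d, hd, hd0, hdQ, H⟩ := G.exists_isDiagonalized_g i hQ
  have h2 : ∀ x l, 0 ≤ l → G.worstCase 2 i x ≤ G.J i x l := fun x l hl => by
    obtain ⟨R, e, H⟩ := H x
    obtain ⟨C, hC⟩ := H.abs_le
    exact G.worstCase_two_le_J i x H.continuous hC hl
  rcases hp with rfl | rfl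
  · by_cases hdz : d = 0
    · exact Or.inl fun x l hl => G.worstCase_one_le_J_of_eq_zero i x (hdQ hdz) hl
    · rcases (G.ε_nonneg i).eq_or_lt with hε | hε
      · refine Or.inl fun x l hl => le_trans ?_ (h2 x l hl)
        refine biSup_mono fun μ hμ => ⟨hμ.1, ?_⟩
        have h := hμ.2
        rw [← hε] at h ⊢
        exact wasserstein_two_le_zero (G.K_pos i) h
      · obtain ⟨j, hj⟩ := Function.ne_iff.1 hdz
        refine Or.inr fun x => ?_
        obtain ⟨R, e, H⟩ := H x
        obtain ⟨v, hv, hg⟩ := H.exists_add_smul_eq j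
        exact G.worstCase_one_eq_top i x hε hv ((hd0 j).lt_of_ne' hj) hg
  · exact Or.inl h2

end DRGame

theorem lemma2 {N n m : ℕ} (G : DRGame N n m) (hQ : G.QuadraticForms)
    (p : ℕ) (hp : p = 1 ∨ p = 2)
    (x : Fin N → EuclideanSpace ℝ (Fin n)) (lam : Fin N → ℝ)
    (h : G.IsRNE x lam) : G.IsDRNE p x := by
  refine ⟨fun i => (h.1 i).1, fun i y hy => ?_⟩
  rcases G.worstCase_le_J_or_eq_top i hQ hp with hle | htop
  · exact G.le_worstCase_of_forall_le_J i _ hQ hp fun l hl =>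
      (hle x (lam i) (h.1 i).2).trans (h.2 i y hy l hl)
  · rw [htop (Function.update x i y)]
    exact le_top
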